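/- For a compact convex set $K\subset\mathbb{R}^2$ with non-empty interior let $\mathrm{cs}(K)=\frac12(K-K)$ be its central symmetral, and for $L\subset\mathbb{R}^2$ let $L^\star=\{y\in\mathbb{R}^2:\langle x,y\rangle\le 1\text{ for all }x\in L\}$ be its polar. For $i=1,2$ let $\lambda_i=\lambda_i(\mathrm{cs}(K)^\star)$ be the $i$-th successive minimum of $\mathrm{cs}(K)^\star$ with respect to $\mathbb{Z}^2$, i.e. the smallest $\lambda>0$ such that $\lambda\,\mathrm{cs}(K)^\star$ contains $i$ linearly independent points of $\mathbb{Z}^2$. Then for every compact convex set $K\subset\mathbb{R}^2$ with non-empty interior, $$\mathrm{vol}(K)\ \ge\ \tfrac32\lambda_1\lambda_2+\tfrac12\lambda_1(\lambda_2-\lambda_1)\ =\ 2\lambda_1\lambda_2-\tfrac12\lambda_1^2 ,$$ where $\mathrm{vol}$ is the Lebesgue measure on $\mathbb{R}^2$. Equality $\mathrm{vol}(K)=\tfrac32\lambda_1\lambda_2+\tfrac12\lambda_1(\lambda_2-\lambda_1)$ holds if and only if there are real numbers $t\ge s>0$, a matrix $U\in\mathrm{GL}(2,\mathbb{Z})$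 and a vector $v\in\mathbb{R}^2$ such that $K=U\,T_{s,t}+v$, where $T_{s,t}=\mathrm{conv}\{(-s,t-s),(s,t),(0,-t)\}$. -/

import Mathlib

open scoped Pointwise

noncomputable section

namespace PlanarPolar

/-- The central symmetral `cs(K) = ½ (K - K)`. -/
def centralSymmetral {n : ℕ} (K : Set (EuclideanSpace ℝ (Fin n))) :
    Set (EuclideanSpace ℝ (Fin n)) :=
  (1 / 2 : ℝ) • (K - K)

/-- The (one-sided) polar `K* = {y : ⟨x, y⟩ ≤ 1 for all x ∈ K}`. -/
def polarBody {n : ℕ} (K : Set (EuclideanSpace ℝ (Fin n))) :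
    Set (EuclideanSpace ℝ (Fin n)) :=
  {y | ∀ x ∈ K, inner ℝ x y ≤ 1}

/-- The lattice `ℤⁿ` in `ℝⁿ`. -/
def integerLattice (n : ℕ) : Set (EuclideanSpace ℝ (Fin n)) :=
  {x | ∀ i, ∃ m : ℤ, x i = (m : ℝ)}

/-- The `i`-th successive minimum of `K` with respect to `ℤⁿ`: the smallest `r > 0` such that
`r K` contains `i` linearly independent lattice points. Here `Set.finrank ℝ S` is the dimension
of the linear span of `S`. -/
def successiveMinimum {n : ℕ} (K : Set (EuclideanSpace ℝ (Fin n))) (i : ℕ) : ℝ :=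
  sInf {r : ℝ | 0 < r ∧ i ≤ Set.finrank ℝ ((r • K) ∩ integerLattice n)}

/-- `K` is the image of `L` under a unimodular transformation (an element of `GL(n, ℤ)`,
acting linearly on `ℝⁿ`) followed by a translation. -/
def UnimodularlyEquivalent {n : ℕ} (K L : Set (EuclideanSpace ℝ (Fin n))) : Prop :=
  ∃ (U : Matrix.GeneralLinearGroup (Fin n) ℤ) (v : EuclideanSpace ℝ (Fin n)),
    K = (fun x => Matrix.toEuclideanLin ((U : Matrix (Fin n) (Fin n) ℤ).map (Int.cast : ℤ → ℝ)) x
      + v) '' L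

/-- The triangle `T_{s,t} = conv {(-s, t - s), (s, t), (0, -t)}`. -/
def triangle (s t : ℝ) : Set (EuclideanSpace ℝ (Fin 2)) :=
  convexHull ℝ {!₂[-s, t - s], !₂[s, t], !₂[0, -t]}

end PlanarPolar

end

open scoped Pointwise
open MeasureTheory

namespace PlanarPolar

/-! The support function of `cs(K)` at `y` is half the width of `K` along `y`, so `y ∈ r • cs(K)*`
says exactly that this half width is at most `r` (`mem_smul_polar_iff`). The successive minima are
therefore those of the half width, which is a norm on directions. A Lagrange-type reduction gives a
basis `u`, `v` of `ℤ²` whose half widths are `s = λ₁` and `t = λ₂`, with `v + k u` of half width at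
least `t` for every integer `k` (`exists_isReducedBasis`, `IsReducedBasis.right_le`).

In the area-preserving coordinates `X = ⟨u, ·⟩`, `Y = ⟨v, ·⟩` the body touches all four sides of a
`2s × 2t` box, and its half widths along `Y - X` and `Y + X` are at least `t`. The points `L`, `R`,
`B`, `T` where it touches the left, right, bottom and top sides span area `2st - pq/2`, where `p = Y
R - Y L` and `q = X T - X B`. If `pq ≤ 0` this already exceeds the bound. Otherwise, after possibly
replacing `X` by `-X`, both `p` and `q` are positive, and the body is too thin along `X - Y` unless
it has further points `P`, `Q` towards the bottom right and top left corners. The triangles `BRP`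
and `LTQ` regain so much area that the net loss is at most `s²/2` (`hexagon_excess`,
`volume_ge_of_hexagon`).

Equality forces the touching points into one of two positions, in which a single triangle, a
translate of `± T_{s,t}`, already has the whole area; a convex body of equal area containing it
coincides with it (`eq_of_volume_le`). Conversely, the coordinates adapted to `T_{s,t}` form a
reduced basis with half widths `s` and `t`, so its minima and area can be read off
(`reduced_of_triangle`). -/

/-- The Euclidean plane. -/
abbrev Plane := EuclideanSpace ℝ (Fin 2)

/-- The determinant of two plane vectors. -/
def cross (x y : Plane) : ℝ := x 0 * y 1 - x 1 * y 0

/-! ### Areas of triangles and of convex sets containing polygons. -/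

theorem convexHull_standard_triangle :
    convexHull ℝ {(0 : Plane), !₂[1, 0], !₂[0, 1]} =
      {x : Plane | 0 ≤ x 0 ∧ 0 ≤ x 1 ∧ x 0 + x 1 ≤ 1} := by
  apply Set.Subset.antisymm
  · apply convexHull_min
    · rintro x (rfl | rfl | rfl) <;> simp
    · intro x hx y hy a b ha hb hab
      simp only [Set.mem_ofPred_eq, PiLp.add_apply, PiLp.smul_apply, smul_eq_mul] at *
      obtain ⟨h1, h2, h3⟩ := hx
      obtain ⟨g1, g2, g3⟩ := hy
      refine ⟨by positivity, by positivity, ?_⟩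
      nlinarith
  · rintro x ⟨h0, h1, h2⟩
    have hx : x = (1 - x 0 - x 1) • (0 : Plane) + x 0 • !₂[1, 0] + x 1 • !₂[0, 1] := by
      ext i; fin_cases i <;> simp
    rw [hx]
    have hc := convex_convexHull ℝ {(0 : Plane), !₂[1, 0], !₂[0, 1]}
    have hs := subset_convexHull ℝ {(0 : Plane), !₂[1, 0], !₂[0, 1]}
    have := hc.sum_mem (t := Finset.univ) (w := ![1 - x 0 - x 1, x 0, x 1])
      (z := ![(0 : Plane), !₂[1, 0], !₂[0, 1]])
      (by intro i _; fin_cases i <;> simp <;> linarith)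
      (by simp [Fin.sum_univ_three]; ring)
      (by intro i _; apply hs; fin_cases i <;> simp)
    simpa [Fin.sum_univ_three] using this

theorem volume_standard_triangle :
    volume {x : Plane | 0 ≤ x 0 ∧ 0 ≤ x 1 ∧ x 0 + x 1 ≤ 1} = ENNReal.ofReal (1 / 2) := by
  let S : Set (ℝ × ℝ) := {p | 0 ≤ p.1 ∧ 0 ≤ p.2 ∧ p.1 + p.2 ≤ 1}
  have hS : MeasurableSet S := by
    apply MeasurableSet.inter (measurableSet_le measurable_const measurable_fst)
    apply MeasurableSet.inter (measurableSet_le measurable_const measurable_snd)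
    exact measurableSet_le (measurable_fst.add measurable_snd) measurable_const
  have hmp := (volume_preserving_finTwoArrow ℝ).comp (PiLp.volume_preserving_ofLp (Fin 2))
  have h1 : {x : Plane | 0 ≤ x 0 ∧ 0 ≤ x 1 ∧ x 0 + x 1 ≤ 1} =
      (MeasurableEquiv.finTwoArrow ∘ WithLp.ofLp) ⁻¹' S := by
    ext x; simp [S, MeasurableEquiv.finTwoArrow]
  rw [h1, hmp.measure_preimage hS.nullMeasurableSet, Measure.volume_eq_prod,
    Measure.prod_apply hS]
  have h2 : ∀ x : ℝ, volume (Prod.mk x ⁻¹' S) =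
      (Set.Icc (0 : ℝ) 1).indicator (fun x => ENNReal.ofReal (1 - x)) x := by
    intro x
    by_cases hx : x ∈ Set.Icc (0 : ℝ) 1
    · rw [Set.indicator_of_mem hx]
      have : Prod.mk x ⁻¹' S = Set.Icc 0 (1 - x) := by
        ext y
        simp only [S, Set.mem_preimage, Set.mem_ofPred_eq, Set.mem_Icc]
        exact ⟨fun h => ⟨h.2.1, by linarith⟩, fun h => ⟨hx.1, h.1, by linarith⟩⟩
      rw [this, Real.volume_Icc, sub_zero]
    · rw [Set.indicator_of_notMem hx]
      have : Prod.mk x ⁻¹' S = ∅ := by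
        ext y
        simp only [S, Set.mem_preimage, Set.mem_ofPred_eq, Set.mem_empty_iff_false, iff_false]
        exact fun h => hx ⟨h.1, by linarith⟩
      rw [this, measure_empty]
  simp_rw [h2]
  rw [lintegral_indicator measurableSet_Icc, ← ofReal_integral_eq_lintegral_ofReal]
  · congr 1
    rw [integral_Icc_eq_integral_Ioc, ← intervalIntegral.integral_of_le zero_le_one]
    rw [intervalIntegral.integral_sub (by simp) (by simp)]
    simp; norm_num
  · exact (by fun_prop : Continuous fun x : ℝ => 1 - x).integrableOn_Icc
  · filter_upwards [ae_restrict_mem measurableSet_Icc] with x hx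
    simpa using hx.2

/-- The area of a triangle. -/
theorem volume_convexHull_triple (A B C : Plane) :
    volume (convexHull ℝ {A, B, C}) = ENNReal.ofReal (|cross (B - A) (C - A)| / 2) := by
  let M : Matrix (Fin 2) (Fin 2) ℝ := !![B 0 - A 0, C 0 - A 0; B 1 - A 1, C 1 - A 1]
  let f : Plane →ₗ[ℝ] Plane := Matrix.toEuclideanLin M
  have hf : ({A, B, C} : Set Plane) = A +ᵥ f '' {(0 : Plane), !₂[1, 0], !₂[0, 1]} := by
    have h1 : f !₂[1, 0] = B - A := by
      ext i; fin_cases i <;> simp [f, M, Matrix.toEuclideanLin, Matrix.toLpLin_apply]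
    have h2 : f !₂[0, 1] = C - A := by
      ext i; fin_cases i <;> simp [f, M, Matrix.toEuclideanLin, Matrix.toLpLin_apply]
    rw [Set.image_insert_eq, Set.image_pair, h1, h2, map_zero]
    ext x; simp [Set.mem_vadd_set]; grind
  have hdet : LinearMap.det f = cross (B - A) (C - A) := by
    have : LinearMap.det f = M.det := by
      simp [f, Matrix.toEuclideanLin, Matrix.toLpLin_eq_toLin]
    rw [this, Matrix.det_fin_two]
    simp [M, cross]; ring
  rw [hf, convexHull_vadd, measure_vadd, ← LinearMap.image_convexHull,
    Measure.addHaar_image_linearMap, convexHull_standard_triangle, volume_standard_triangle, hdet,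
    ← ENNReal.ofReal_mul (abs_nonneg _)]
  congr 1; ring

theorem volume_level_eq_zero {f : Plane →ₗ[ℝ] ℝ} (hf : f ≠ 0) (c : ℝ) :
    volume {x | f x = c} = 0 := by
  rcases Set.eq_empty_or_nonempty {x | f x = c} with h | ⟨x₀, hx₀⟩
  · rw [h, measure_empty]
  · have : {x | f x = c} = x₀ +ᵥ (LinearMap.ker f : Set Plane) := by
      ext x
      simp only [Set.mem_ofPred_eq, Set.mem_vadd_set_iff_neg_vadd_mem] at hx₀ ⊢
      simp only [SetLike.mem_coe, LinearMap.mem_ker, vadd_eq_add, map_add, map_neg, hx₀]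
      constructor <;> intro h <;> linarith
    rw [this, measure_vadd]
    exact Measure.addHaar_submodule _ _ (by simpa [LinearMap.ker_eq_top] using hf)

/-- The overlap lies on a line, which is null. This makes the areas of triangles on opposite sides
of a common edge add up. -/
theorem volume_union_of_separated {f : Plane →ₗ[ℝ] ℝ} (hf : f ≠ 0) (c : ℝ) {S T : Set Plane}
    (hT : MeasurableSet T) (hSf : ∀ x ∈ S, f x ≤ c) (hTf : ∀ x ∈ T, c ≤ f x) :
    volume (S ∪ T) = volume S + volume T := by
  apply measure_union₀ hT.nullMeasurableSet
  apply measure_mono_null _ (volume_level_eq_zero hf c)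
  exact fun x hx => le_antisymm (hSf x hx.1) (hTf x hx.2)

/-- Two linear coordinates on the plane that preserve area. -/
def UnimodularPair (X Y : Plane →ₗ[ℝ] ℝ) : Prop :=
  ∀ a b, |X a * Y b - Y a * X b| = |cross a b|

/-- Twice the signed area of a triangle, in the coordinates `X`, `Y`. -/
def signedArea (X Y : Plane →ₗ[ℝ] ℝ) (A B C : Plane) : ℝ :=
  (X B - X A) * (Y C - Y A) - (Y B - Y A) * (X C - X A)

variable {X Y : Plane →ₗ[ℝ] ℝ}

theorem volume_triangle_eq (h : UnimodularPair X Y) (A B C : Plane) :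
    volume (convexHull ℝ {A, B, C}) = ENNReal.ofReal (|signedArea X Y A B C| / 2) := by
  rw [volume_convexHull_triple, ← h, signedArea]
  simp only [map_sub]

theorem measurableSet_triangle (A B C : Plane) : MeasurableSet (convexHull ℝ {A, B, C}) :=
  (Set.Finite.isCompact_convexHull ℝ (by simp)).measurableSet

/-- The linear form vanishing in the direction of the line `AB`. -/
def sideForm (X Y : Plane →ₗ[ℝ] ℝ) (A B : Plane) : Plane →ₗ[ℝ] ℝ :=
  (X B - X A) • Y - (Y B - Y A) • X

/-- Signed area is affine in the third vertex, so its sign tells on which side of the line `AB` that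
vertex lies. -/
theorem sideForm_sub (A B C : Plane) :
    sideForm X Y A B C - sideForm X Y A B A = signedArea X Y A B C := by
  simp [sideForm, signedArea]; ring

theorem sideForm_ne_zero (h : UnimodularPair X Y) {A B : Plane} (hAB : A ≠ B) :
    sideForm X Y A B ≠ 0 := by
  intro h0
  have h1 : ∀ w, sideForm X Y A B w = 0 := fun w => by rw [h0]; rfl
  -- The test vector is `B - A` turned by a right angle; its cross product with `B - A` is the
  -- squared length of `B - A`.
  have h2 := h (B - A) !₂[-(B - A) 1, (B - A) 0]
  have h3 := h1 !₂[-(B - A) 1, (B - A) 0]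
  simp only [sideForm, LinearMap.sub_apply, LinearMap.smul_apply, smul_eq_mul] at h3
  simp only [map_sub] at h2
  rw [h3, abs_zero, eq_comm, abs_eq_zero] at h2
  simp [cross] at h2
  apply hAB
  have e0 : B 0 - A 0 = 0 :=
    pow_eq_zero_iff two_ne_zero |>.1 (by nlinarith [sq_nonneg (B 0 - A 0), sq_nonneg (B 1 - A 1)])
  have e1 : B 1 - A 1 = 0 :=
    pow_eq_zero_iff two_ne_zero |>.1 (by nlinarith [sq_nonneg (B 0 - A 0), sq_nonneg (B 1 - A 1)])
  ext i; fin_cases i <;> simp <;> linarith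

theorem le_on_triangle (f : Plane →ₗ[ℝ] ℝ) {c : ℝ} {A B C : Plane} (hA : f A ≤ c) (hB : f B ≤ c)
    (hC : f C ≤ c) : ∀ x ∈ convexHull ℝ {A, B, C}, f x ≤ c := by
  intro x hx
  have : convexHull ℝ {A, B, C} ⊆ {x | f x ≤ c} := by
    apply convexHull_min
    · rintro y (rfl | rfl | rfl) <;> assumption
    · exact convex_halfSpace_le f.isLinear c
  exact this hx

theorem ge_on_triangle (f : Plane →ₗ[ℝ] ℝ) {c : ℝ} {A B C : Plane} (hA : c ≤ f A) (hB : c ≤ f B)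
    (hC : c ≤ f C) : ∀ x ∈ convexHull ℝ {A, B, C}, c ≤ f x := by
  intro x hx
  have : convexHull ℝ {A, B, C} ⊆ {x | c ≤ f x} := by
    apply convexHull_min
    · rintro y (rfl | rfl | rfl) <;> assumption
    · exact convex_halfSpace_ge f.isLinear c
  exact this hx

theorem triangle_subset {K : Set Plane} (hK : Convex ℝ K) {A B C : Plane} (hA : A ∈ K) (hB : B ∈ K)
    (hC : C ∈ K) : convexHull ℝ {A, B, C} ⊆ K := by
  apply convexHull_min _ hK
  rintro y (rfl | rfl | rfl) <;> assumption

/-- Area bound for a convex set containing a quadrilateral with diagonal `AB`. -/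
theorem volume_ge_of_quadrilateral (h : UnimodularPair X Y) {K : Set Plane} (hK : Convex ℝ K)
    (hfin : volume K ≠ ⊤) {A B C D : Plane} (hA : A ∈ K) (hB : B ∈ K) (hC : C ∈ K) (hD : D ∈ K)
    (hAB : A ≠ B) (hCs : signedArea X Y A B C ≤ 0) (hDs : 0 ≤ signedArea X Y A B D) :
    (signedArea X Y A B D - signedArea X Y A B C) / 2 ≤ volume.real K := by
  have hC' := sideForm_sub (X := X) (Y := Y) A B C
  have hD' := sideForm_sub (X := X) (Y := Y) A B D
  have hB' : sideForm X Y A B B = sideForm X Y A B A := by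
    have := sideForm_sub (X := X) (Y := Y) A B B
    have : signedArea X Y A B B = 0 := by simp [signedArea]; ring
    linarith
  have hu := volume_union_of_separated (sideForm_ne_zero h hAB) (sideForm X Y A B A)
    (measurableSet_triangle A B D)
    (le_on_triangle (A := A) (B := B) (C := C) _ le_rfl hB'.le (by linarith))
    (ge_on_triangle _ le_rfl hB'.ge (by linarith))
  have hsub : convexHull ℝ {A, B, C} ∪ convexHull ℝ {A, B, D} ⊆ K :=
    Set.union_subset (triangle_subset hK hA hB hC) (triangle_subset hK hA hB hD)
  have hle := measure_mono (μ := volume) hsub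
  rw [hu, volume_triangle_eq h, volume_triangle_eq h, abs_of_nonpos hCs, abs_of_nonneg hDs,
    ← ENNReal.ofReal_add (by linarith) (by linarith)] at hle
  have := (ENNReal.ofReal_le_iff_le_toReal hfin).1 hle
  rw [Measure.real]
  linarith

/-- Area bound for a convex set containing a hexagon `A C E B D F` with diagonal `AB`. -/
theorem volume_ge_of_hexagon (h : UnimodularPair X Y) {K : Set Plane} (hK : Convex ℝ K)
    (hfin : volume K ≠ ⊤) {A B C D E F : Plane} (hA : A ∈ K) (hB : B ∈ K) (hC : C ∈ K) (hD : D ∈ K)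
    (hE : E ∈ K) (hF : F ∈ K)
    (hAB : A ≠ B) (hCB : C ≠ B) (hAD : A ≠ D)
    (hCs : signedArea X Y A B C ≤ 0) (hDs : 0 ≤ signedArea X Y A B D)
    (hEs : signedArea X Y A B E ≤ 0) (hFs : 0 ≤ signedArea X Y A B F)
    (hE' : signedArea X Y C B E ≤ 0) (hF' : 0 ≤ signedArea X Y A D F) :
    (signedArea X Y A B D - signedArea X Y A B C - signedArea X Y C B E + signedArea X Y A D F) / 2
      ≤ volume.real K := by
  have self_B : ∀ A B, sideForm X Y A B B = sideForm X Y A B A := fun A B => by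
    have := sideForm_sub (X := X) (Y := Y) A B B
    have : signedArea X Y A B B = 0 := by simp [signedArea]; ring
    linarith
  have hC₁ := sideForm_sub (X := X) (Y := Y) A B C
  have hD₁ := sideForm_sub (X := X) (Y := Y) A B D
  have hE₁ := sideForm_sub (X := X) (Y := Y) A B E
  have hF₁ := sideForm_sub (X := X) (Y := Y) A B F
  have hE₂ := sideForm_sub (X := X) (Y := Y) C B E
  have hF₂ := sideForm_sub (X := X) (Y := Y) A D F
  have hA₂ : signedArea X Y C B A = - signedArea X Y A B C := by simp only [signedArea]; ring
  have hB₂ : signedArea X Y A D B = - signedArea X Y A B D := by simp only [signedArea]; ring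
  have hA₃ := sideForm_sub (X := X) (Y := Y) C B A
  have hB₃ := sideForm_sub (X := X) (Y := Y) A D B
  -- The line `CB` separates `CBE` from `ABC`, the line `AD` separates `ABD` from `ADF`, and finally
  -- `AB` separates the two pairs.
  have hu₁ := volume_union_of_separated (sideForm_ne_zero h hCB) (sideForm X Y C B C)
    (measurableSet_triangle A B C)
    (le_on_triangle (A := C) (B := B) (C := E) _ le_rfl (self_B C B).le (by linarith))
    (ge_on_triangle (A := A) (B := B) (C := C) _ (by linarith) (self_B C B).ge le_rfl)
  have hu₂ := volume_union_of_separated (sideForm_ne_zero h hAD) (sideForm X Y A D A)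
    (measurableSet_triangle A D F)
    (le_on_triangle (A := A) (B := B) (C := D) _ le_rfl (by linarith) (self_B A D).le)
    (ge_on_triangle (A := A) (B := D) (C := F) _ le_rfl (self_B A D).ge (by linarith))
  have hu := volume_union_of_separated (sideForm_ne_zero h hAB) (sideForm X Y A B A)
    (S := convexHull ℝ {C, B, E} ∪ convexHull ℝ {A, B, C})
    (T := convexHull ℝ {A, B, D} ∪ convexHull ℝ {A, D, F})
    ((measurableSet_triangle A B D).union (measurableSet_triangle A D F))
    (by
      rintro x (hx | hx)
      · exact le_on_triangle _ (by linarith) (self_B A B).le (by linarith) x hx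
      · exact le_on_triangle _ le_rfl (self_B A B).le (by linarith) x hx)
    (by
      rintro x (hx | hx)
      · exact ge_on_triangle _ le_rfl (self_B A B).ge (by linarith) x hx
      · exact ge_on_triangle _ le_rfl (by linarith) (by linarith) x hx)
  have hsub : (convexHull ℝ {C, B, E} ∪ convexHull ℝ {A, B, C}) ∪
      (convexHull ℝ {A, B, D} ∪ convexHull ℝ {A, D, F}) ⊆ K :=
    Set.union_subset
      (Set.union_subset (triangle_subset hK hC hB hE) (triangle_subset hK hA hB hC))
      (Set.union_subset (triangle_subset hK hA hB hD) (triangle_subset hK hA hD hF))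
  have hle := measure_mono (μ := volume) hsub
  rw [hu, hu₁, hu₂, volume_triangle_eq h, volume_triangle_eq h, volume_triangle_eq h,
    volume_triangle_eq h, abs_of_nonpos hCs, abs_of_nonneg hDs, abs_of_nonpos hE',
    abs_of_nonneg hF', ← ENNReal.ofReal_add (by linarith) (by linarith),
    ← ENNReal.ofReal_add (by linarith) (by linarith),
    ← ENNReal.ofReal_add (by linarith) (by linarith)] at hle
  have := (ENNReal.ofReal_le_iff_le_toReal hfin).1 hle
  rw [Measure.real]
  linarith

/-- A convex body that contains a closed set of the same finite area is equal to it. -/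
theorem eq_of_volume_le {K T : Set Plane} (hK : Convex ℝ K)
    (hKi : (interior K).Nonempty) (hT : IsClosed T) (hTK : T ⊆ K) (hfin : volume K ≠ ⊤)
    (hv : volume K ≤ volume T) : K = T := by
  refine Set.Subset.antisymm ?_ hTK
  -- Otherwise the open set `interior K \ T` would add positive area to `T` inside `K`.
  have hint : interior K ⊆ T := by
    by_contra hne
    obtain ⟨x, hx, hxT⟩ := Set.not_subset.1 hne
    have hopen : IsOpen (interior K \ T) := isOpen_interior.sdiff hT
    have hpos : 0 < volume (interior K \ T) := hopen.measure_pos volume ⟨x, hx, hxT⟩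
    have h1 : volume (T ∪ (interior K \ T)) = volume T + volume (interior K \ T) :=
      measure_union Set.disjoint_sdiff_right hopen.measurableSet
    have h2 : volume (T ∪ (interior K \ T)) ≤ volume K :=
      measure_mono (Set.union_subset hTK (Set.sdiff_subset.trans interior_subset))
    have hTfin : volume T ≠ ⊤ := ne_top_of_le_ne_top hfin (measure_mono hTK)
    have h3 : volume T < volume T + volume (interior K \ T) :=
      ENNReal.lt_add_right hTfin hpos.ne'
    exact absurd (h3.trans_le (h1 ▸ h2)) (not_lt.2 hv)
  calc K ⊆ closure (interior K) := by
        rw [hK.closure_interior_eq_closure_of_nonempty_interior hKi]; exact subset_closure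
    _ ⊆ T := closure_minimal hint hT

/-! ### The inequality for the inscribed hexagon. -/

/-- The excess area of a hexagon inscribed in the box `[0, 2s] × [0, 2t]` whose width in direction
`(1, -1)` is at least `2t`, and the two extremal configurations. -/
theorem hexagon_excess {s t a b c d x₁ y₁ x₂ y₂ : ℝ} (hs : 0 < s) (hst : s ≤ t)
    (ha : 0 ≤ a) (hab : a < b) (hb : b ≤ 2 * t) (hc : 0 ≤ c) (hcd : c < d) (hd : d ≤ 2 * s)
    (hx₁' : x₁ ≤ 2 * s) (hy₁ : 0 ≤ y₁)
    (hx₂ : 0 ≤ x₂) (hy₂' : y₂ ≤ 2 * t)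
    (hP₁ : c ≤ x₁ - y₁) (hP₂ : 2 * s - b ≤ x₁ - y₁)
    (hQ₁ : x₂ - y₂ ≤ -a) (hQ₂ : x₂ - y₂ ≤ d - 2 * t)
    (hw : 2 * t ≤ (x₁ - y₁) - (x₂ - y₂)) :
    0 ≤ b * (x₁ - c) - (2 * s - c) * y₁ ∧ 0 ≤ d * (y₂ - a) - (2 * t - a) * x₂ ∧
    (b - a) * (d - c) - (b * (x₁ - c) - (2 * s - c) * y₁) - (d * (y₂ - a) - (2 * t - a) * x₂)
      ≤ s ^ 2 ∧
    ((b - a) * (d - c) - (b * (x₁ - c) - (2 * s - c) * y₁) - (d * (y₂ - a) - (2 * t - a) * x₂)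
      = s ^ 2 → (a = 2 * t - s ∧ b = 2 * t ∧ c = s ∧ d = 2 * s) ∨
        (a = 0 ∧ b = s ∧ c = 0 ∧ d = s)) := by
  -- With `L = (0, a)`, `R = (2s, b)`, `B = (c, 0)`, `T = (d, 2t)`, `P = (x₁, y₁)`, `Q = (x₂, y₂)`,
  -- the numbers `G` and `H` are twice the areas of `BRP` and `LTQ`, and `(b - a)(d - c)` is twice
  -- the area that `LBRT` lacks from `2st`.
  set G := b * (x₁ - c) - (2 * s - c) * y₁ with hG
  set H := d * (y₂ - a) - (2 * t - a) * x₂ with hH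
  set m := x₁ - y₁ with hm
  set n := x₂ - y₂ with hn
  have hp : 0 < b - a := by linarith
  have hq : 0 < d - c := by linarith
  -- For fixed `m`, `G` is linear along the line `x₁ - y₁ = m`. Its least value in the box is at `y₁
  -- = 0` or at `x₁ = 2s`, according to which of `B`, `R` has the larger value of `x - y`. The same
  -- holds for `H`, with `L` and `T`.
  rcases le_total (2 * s - b) c with h1 | h1 <;> rcases le_total (2 * t - d) a with h2 | h2
  · have g : b * (m - c) ≤ G := by nlinarith [mul_nonneg (by linarith : 0 ≤ b - 2 * s + c) hy₁]
    have k : d * (-a - n) ≤ H := by nlinarith [mul_nonneg (by linarith : 0 ≤ d + a - 2 * t) hx₂]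
    have hμ : 0 ≤ m - c := by linarith
    have hν : 0 ≤ -a - n := by linarith
    have hbμ : 0 ≤ b * (m - c) := mul_nonneg (by linarith) hμ
    have hdν : 0 ≤ d * (-a - n) := mul_nonneg (by linarith) hν
    have e₁ : 0 ≤ a * (m - c) := mul_nonneg ha hμ
    have e₂ : 0 ≤ (d - (b - a)) * (-a - n) := mul_nonneg (by linarith) hν
    have e₃ : 0 ≤ (b - a) * (m - n - 2 * t) := mul_nonneg hp.le (by linarith)
    have e₄ : 0 ≤ (b - a) * (2 * t - b) := mul_nonneg hp.le (by linarith)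
    have e₅ : 0 ≤ (b - a) * (2 * s - d) := mul_nonneg hp.le (by linarith)
    -- Every term subtracted from `s ^ 2` is nonnegative, so equality makes each vanish and fixes
    -- `a`, `b`, `c`, `d`.
    have key : (b - a) * (d - c) - b * (m - c) - d * (-a - n) = s ^ 2 - (b - a - s) ^ 2
        - a * (m - c) - (d - (b - a)) * (-a - n) - (b - a) * (m - n - 2 * t)
        - (b - a) * (2 * t - b) - (b - a) * (2 * s - d) := by ring
    have e₆ := sq_nonneg (b - a - s)
    refine ⟨by linarith, by linarith, by linarith, fun heq => Or.inl ?_⟩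
    have z₁ : b - a - s = 0 := pow_eq_zero_iff two_ne_zero |>.1 (by linarith)
    have z₂ : 2 * t - b = 0 :=
      (mul_eq_zero.1 (by linarith : (b - a) * (2 * t - b) = 0)).resolve_left hp.ne'
    have z₃ : 2 * s - d = 0 :=
      (mul_eq_zero.1 (by linarith : (b - a) * (2 * s - d) = 0)).resolve_left hp.ne'
    have z₄ : m - c = 0 :=
      (mul_eq_zero.1 (by linarith : a * (m - c) = 0)).resolve_left (by linarith)
    have z₅ : -a - n = 0 :=
      (mul_eq_zero.1 (by linarith : (d - (b - a)) * (-a - n) = 0)).resolve_left (by linarith)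
    have z₆ : m - n - 2 * t = 0 :=
      (mul_eq_zero.1 (by linarith : (b - a) * (m - n - 2 * t) = 0)).resolve_left hp.ne'
    refine ⟨?_, ?_, ?_, ?_⟩ <;> linarith
  · have g : b * (m - c) ≤ G := by nlinarith [mul_nonneg (by linarith : 0 ≤ b - 2 * s + c) hy₁]
    have k : (2 * t - a) * (d - 2 * t - n) ≤ H := by
      nlinarith [mul_nonneg (by linarith : 0 ≤ 2 * t - a - d) (by linarith : 0 ≤ 2 * t - y₂)]
    have hμ : 0 ≤ m - c := by linarith
    have hν : 0 ≤ d - 2 * t - n := by linarith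
    have e₁ : (b - a) * (m - c) ≤ b * (m - c) := mul_le_mul_of_nonneg_right (by linarith) hμ
    have e₂ : (b - a) * (d - 2 * t - n) ≤ (2 * t - a) * (d - 2 * t - n) :=
      mul_le_mul_of_nonneg_right (by linarith) hν
    -- By the width condition `m - n ≥ 2t` the second factor is at least `d - c`: in the mixed cases
    -- `G + H` makes up for the whole loss and equality is impossible.
    have e₃ : (b - a) * (d - c) ≤ (b - a) * ((m - c) + (d - 2 * t - n)) :=
      mul_le_mul_of_nonneg_left (by linarith) hp.le
    have e₄ : 0 ≤ (b - a) * (m - c) := mul_nonneg hp.le hμ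
    have e₅ : 0 ≤ (b - a) * (d - 2 * t - n) := mul_nonneg hp.le hν
    have hs2 : 0 < s ^ 2 := by positivity
    refine ⟨by linarith, by linarith, by linarith, fun heq => absurd heq ?_⟩
    apply ne_of_lt
    linarith
  · have g : (2 * s - c) * (m - (2 * s - b)) ≤ G := by
      nlinarith [mul_nonneg (by linarith : 0 ≤ 2 * s - b - c) (by linarith : 0 ≤ 2 * s - x₁)]
    have k : d * (-a - n) ≤ H := by nlinarith [mul_nonneg (by linarith : 0 ≤ d + a - 2 * t) hx₂]
    have hμ : 0 ≤ m - (2 * s - b) := by linarith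
    have hν : 0 ≤ -a - n := by linarith
    have e₁ : (d - c) * (m - (2 * s - b)) ≤ (2 * s - c) * (m - (2 * s - b)) :=
      mul_le_mul_of_nonneg_right (by linarith) hμ
    have e₂ : (d - c) * (-a - n) ≤ d * (-a - n) := mul_le_mul_of_nonneg_right (by linarith) hν
    have e₃ : (d - c) * (b - a) ≤ (d - c) * ((m - (2 * s - b)) + (-a - n)) :=
      mul_le_mul_of_nonneg_left (by linarith) hq.le
    have e₄ : 0 ≤ (d - c) * (m - (2 * s - b)) := mul_nonneg hq.le hμ
    have e₅ : 0 ≤ (d - c) * (-a - n) := mul_nonneg hq.le hν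
    have hs2 : 0 < s ^ 2 := by positivity
    refine ⟨by linarith, by linarith, by linarith, fun heq => absurd heq ?_⟩
    apply ne_of_lt
    linarith
  · have g : (2 * s - c) * (m - (2 * s - b)) ≤ G := by
      nlinarith [mul_nonneg (by linarith : 0 ≤ 2 * s - b - c) (by linarith : 0 ≤ 2 * s - x₁)]
    have k : (2 * t - a) * (d - 2 * t - n) ≤ H := by
      nlinarith [mul_nonneg (by linarith : 0 ≤ 2 * t - a - d) (by linarith : 0 ≤ 2 * t - y₂)]
    have hμ : 0 ≤ m - (2 * s - b) := by linarith
    have hν : 0 ≤ d - 2 * t - n := by linarith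
    have hμ' : 0 ≤ (2 * s - c) * (m - (2 * s - b)) := mul_nonneg (by linarith) hμ
    have hν' : 0 ≤ (2 * t - a) * (d - 2 * t - n) := mul_nonneg (by linarith) hν
    have e₁ : 0 ≤ (2 * s - d) * (m - (2 * s - b)) := mul_nonneg (by linarith) hμ
    have e₂ : 0 ≤ (2 * t - a - (d - c)) * (d - 2 * t - n) := mul_nonneg (by linarith) hν
    have e₃ : 0 ≤ (d - c) * (m - n - 2 * t) := mul_nonneg hq.le (by linarith)
    have e₄ : 0 ≤ (d - c) * a := mul_nonneg hq.le ha
    have e₅ : 0 ≤ (d - c) * c := mul_nonneg hq.le hc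
    have key : (b - a) * (d - c) - (2 * s - c) * (m - (2 * s - b))
        - (2 * t - a) * (d - 2 * t - n) = s ^ 2 - (d - c - s) ^ 2
        - (2 * s - d) * (m - (2 * s - b)) - (2 * t - a - (d - c)) * (d - 2 * t - n)
        - (d - c) * (m - n - 2 * t) - (d - c) * a - (d - c) * c := by ring
    have e₆ := sq_nonneg (d - c - s)
    refine ⟨by linarith, by linarith, by linarith, fun heq => Or.inr ?_⟩
    have z₁ : d - c - s = 0 := pow_eq_zero_iff two_ne_zero |>.1 (by linarith)
    have z₂ : a = 0 := (mul_eq_zero.1 (by linarith : (d - c) * a = 0)).resolve_left hq.ne'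
    have z₃ : c = 0 := (mul_eq_zero.1 (by linarith : (d - c) * c = 0)).resolve_left hq.ne'
    have z₄ : m - (2 * s - b) = 0 :=
      (mul_eq_zero.1 (by linarith : (2 * s - d) * (m - (2 * s - b)) = 0)).resolve_left
        (by linarith)
    have z₅ : d - 2 * t - n = 0 :=
      (mul_eq_zero.1 (by linarith : (2 * t - a - (d - c)) * (d - 2 * t - n) = 0)).resolve_left
        (by linarith)
    have z₆ : m - n - 2 * t = 0 :=
      (mul_eq_zero.1 (by linarith : (d - c) * (m - n - 2 * t) = 0)).resolve_left hq.ne'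
    refine ⟨?_, ?_, ?_, ?_⟩ <;> linarith

/-! ### Half widths and the area bound in box coordinates. -/

/-- Half the width of `K` along the linear form `f`. -/
noncomputable def halfWidth (K : Set Plane) (f : Plane →ₗ[ℝ] ℝ) : ℝ :=
  (sSup (f '' K) - sInf (f '' K)) / 2

theorem halfWidth_eq {K : Set Plane} {f : Plane →ₗ[ℝ] ℝ} {p q : Plane} (hp : p ∈ K) (hq : q ∈ K)
    (hp' : ∀ x ∈ K, f x ≤ f p) (hq' : ∀ x ∈ K, f q ≤ f x) :
    halfWidth K f = (f p - f q) / 2 := by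
  have h1 : IsGreatest (f '' K) (f p) :=
    ⟨Set.mem_image_of_mem f hp, by rintro _ ⟨x, hx, rfl⟩; exact hp' x hx⟩
  have h2 : IsLeast (f '' K) (f q) :=
    ⟨Set.mem_image_of_mem f hq, by rintro _ ⟨x, hx, rfl⟩; exact hq' x hx⟩
  rw [halfWidth, h1.csSup_eq, h2.csInf_eq]

theorem exists_extremal {K : Set Plane} (hK : IsCompact K) (hne : K.Nonempty)
    (f : Plane →ₗ[ℝ] ℝ) :
    ∃ p ∈ K, ∃ q ∈ K, (∀ x ∈ K, f x ≤ f p) ∧ (∀ x ∈ K, f q ≤ f x) ∧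
      halfWidth K f = (f p - f q) / 2 := by
  have hf : Continuous f := f.continuous_of_finiteDimensional
  obtain ⟨p, hp, hp'⟩ := hK.exists_isMaxOn hne hf.continuousOn
  obtain ⟨q, hq, hq'⟩ := hK.exists_isMinOn hne hf.continuousOn
  exact ⟨p, hp, q, hq, hp', hq', halfWidth_eq hp hq hp' hq'⟩

/-- `K` is, in the coordinates `X`, `Y`, a translate of the triangle `± T_{s,t}`. -/
def IsExtremalTriangle (X Y : Plane →ₗ[ℝ] ℝ) (K : Set Plane) (s t : ℝ) : Prop :=
  ∃ A B C : Plane, ∃ α β σ : ℝ, (σ = 1 ∨ σ = -1) ∧ K = convexHull ℝ {A, B, C} ∧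
    X A = α + σ * (-s) ∧ Y A = β + σ * (t - s) ∧ X B = α + σ * s ∧ Y B = β + σ * t ∧
    X C = α ∧ Y C = β + σ * (-t)

theorem eq_triangle_of_volume (h : UnimodularPair X Y) {K : Set Plane} (hK : Convex ℝ K)
    (hKc : IsCompact K) (hKi : (interior K).Nonempty) {A B C : Plane} (hA : A ∈ K) (hB : B ∈ K)
    (hC : C ∈ K) (hv : volume.real K = |signedArea X Y A B C| / 2) :
    K = convexHull ℝ {A, B, C} := by
  have hfin : volume K ≠ ⊤ := hKc.measure_lt_top.ne
  refine eq_of_volume_le hK hKi (Set.Finite.isCompact_convexHull ℝ (by simp)).isClosed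
    (triangle_subset hK hA hB hC) hfin ?_
  rw [volume_triangle_eq h, ← hv, Measure.real, ENNReal.ofReal_toReal hfin]

-- Positive `p` and `q` tilt the quadrilateral of touching points along the diagonal, so that the
-- width along `X - Y` is the one that forces additional area.
set_option maxHeartbeats 400000 in
theorem area_bound_of_positive_slopes (h : UnimodularPair X Y) {K : Set Plane} (hK : Convex ℝ K)
    (hKc : IsCompact K) (hKi : (interior K).Nonempty) {s t : ℝ} (hs : 0 < s) (hst : s ≤ t)
    {L R B T : Plane} (hL : L ∈ K) (hR : R ∈ K) (hB : B ∈ K) (hT : T ∈ K)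
    (hL' : ∀ x ∈ K, X L ≤ X x) (hR' : ∀ x ∈ K, X x ≤ X R)
    (hB' : ∀ x ∈ K, Y B ≤ Y x) (hT' : ∀ x ∈ K, Y x ≤ Y T)
    (hLR : X R - X L = 2 * s) (hBT : Y T - Y B = 2 * t) (hw : t ≤ halfWidth K (X - Y))
    (hp : Y L < Y R) (hq : X B < X T) :
    2 * s * t - s ^ 2 / 2 ≤ volume.real K ∧
      (volume.real K = 2 * s * t - s ^ 2 / 2 → IsExtremalTriangle X Y K s t) := by
  have hfin : volume K ≠ ⊤ := hKc.measure_lt_top.ne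
  obtain ⟨P, hP, Q, hQ, hP', hQ', hPQ⟩ := exists_extremal hKc ⟨L, hL⟩ (X - Y)
  simp only [LinearMap.sub_apply] at hP' hQ' hPQ
  obtain ⟨a, ha⟩ : ∃ a, Y L = Y B + a := ⟨_, (add_sub_cancel _ _).symm⟩
  obtain ⟨b, hb⟩ : ∃ b, Y R = Y B + b := ⟨_, (add_sub_cancel _ _).symm⟩
  obtain ⟨c, hc⟩ : ∃ c, X B = X L + c := ⟨_, (add_sub_cancel _ _).symm⟩
  obtain ⟨d, hd⟩ : ∃ d, X T = X L + d := ⟨_, (add_sub_cancel _ _).symm⟩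
  obtain ⟨x₁, hx₁⟩ : ∃ x₁, X P = X L + x₁ := ⟨_, (add_sub_cancel _ _).symm⟩
  obtain ⟨y₁, hy₁⟩ : ∃ y₁, Y P = Y B + y₁ := ⟨_, (add_sub_cancel _ _).symm⟩
  obtain ⟨x₂, hx₂⟩ : ∃ x₂, X Q = X L + x₂ := ⟨_, (add_sub_cancel _ _).symm⟩
  obtain ⟨y₂, hy₂⟩ : ∃ y₂, Y Q = Y B + y₂ := ⟨_, (add_sub_cancel _ _).symm⟩
  have hXR : X R = X L + 2 * s := by linarith
  have hYT : Y T = Y B + 2 * t := by linarith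
  have ha0 : 0 ≤ a := by linarith [hB' L hL]
  have hb2 : b ≤ 2 * t := by linarith [hT' R hR]
  have hc0 : 0 ≤ c := by linarith [hL' B hB]
  have hd2 : d ≤ 2 * s := by linarith [hR' T hT]
  have hab : a < b := by linarith
  have hcd : c < d := by linarith
  have hx₁2 : x₁ ≤ 2 * s := by linarith [hR' P hP]
  have hy₁0 : 0 ≤ y₁ := by linarith [hB' P hP]
  have hx₂0 : 0 ≤ x₂ := by linarith [hL' Q hQ]
  have hy₂2 : y₂ ≤ 2 * t := by linarith [hT' Q hQ]
  obtain ⟨hG, hH, hle, heq⟩ := hexagon_excess hs hst ha0 hab hb2 hc0 hcd hd2 hx₁2 hy₁0 hx₂0 hy₂2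
    (by linarith [hP' B hB]) (by linarith [hP' R hR]) (by linarith [hQ' L hL])
    (by linarith [hQ' T hT]) (by linarith)
  have sLRB : signedArea X Y L R B = -(2 * s * a + (b - a) * c) := by
    simp only [signedArea, ha, hb, hc, hXR]; ring
  have sLRT : signedArea X Y L R T = 2 * s * (2 * t - a) - (b - a) * d := by
    simp only [signedArea, ha, hb, hd, hXR, hYT]; ring
  have sLRP : signedArea X Y L R P = 2 * s * (y₁ - a) - (b - a) * x₁ := by
    simp only [signedArea, ha, hb, hx₁, hy₁, hXR]; ring
  have sLRQ : signedArea X Y L R Q = 2 * s * (y₂ - a) - (b - a) * x₂ := by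
    simp only [signedArea, ha, hb, hx₂, hy₂, hXR]; ring
  have sBRP : signedArea X Y B R P = -(b * (x₁ - c) - (2 * s - c) * y₁) := by
    simp only [signedArea, hb, hc, hx₁, hy₁, hXR]; ring
  have sLTQ : signedArea X Y L T Q = d * (y₂ - a) - (2 * t - a) * x₂ := by
    simp only [signedArea, ha, hd, hx₂, hy₂, hYT]; ring
  have hLRT0 : 0 ≤ 2 * s * (2 * t - a) - (b - a) * d := by
    have := mul_le_mul (by linarith : b - a ≤ 2 * t - a) hd2 (by linarith) (by linarith)
    linarith
  -- `P` lies beyond the edge `BR` and within `x ≤ 2s`, hence below `LR`. The identity, scaled by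
  -- `2s - c > 0`, expresses this through `G ≥ 0` and `2s - x₁ ≥ 0`; for `Q` the analogous scale is
  -- `d`.
  have hLRP0 : 2 * s * (y₁ - a) - (b - a) * x₁ ≤ 0 := by
    have h2c : 0 < 2 * s - c := by linarith
    have e : (2 * s - c) * (2 * s * (y₁ - a) - (b - a) * x₁) =
        -(2 * s * (b * (x₁ - c) - (2 * s - c) * y₁))
        - ((2 * s - c) * a + b * c) * (2 * s - x₁) := by ring
    have e₁ : 0 ≤ 2 * s * (b * (x₁ - c) - (2 * s - c) * y₁) := by positivity
    have e₂ : 0 ≤ ((2 * s - c) * a + b * c) * (2 * s - x₁) :=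
      mul_nonneg (add_nonneg (mul_nonneg h2c.le ha0) (mul_nonneg (by linarith) hc0)) (by linarith)
    by_contra hcon
    have := mul_pos h2c (not_le.1 hcon)
    linarith
  have hLRQ0 : 0 ≤ 2 * s * (y₂ - a) - (b - a) * x₂ := by
    have hd0 : 0 < d := by linarith
    have e : d * (2 * s * (y₂ - a) - (b - a) * x₂) =
        2 * s * (d * (y₂ - a) - (2 * t - a) * x₂) +
        x₂ * (2 * s * (2 * t - a) - (b - a) * d) := by ring
    have e₁ : 0 ≤ 2 * s * (d * (y₂ - a) - (2 * t - a) * x₂) := by positivity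
    have e₂ := mul_nonneg hx₂0 hLRT0
    by_contra hcon
    have := mul_neg_of_pos_of_neg hd0 (not_le.1 hcon)
    linarith
  have hne₁ : L ≠ R := by rintro rfl; linarith
  have hne₂ : B ≠ R := by rintro rfl; linarith
  have hne₃ : L ≠ T := by rintro rfl; linarith
  have hvol := volume_ge_of_hexagon h hK hfin hL hR hB hT hP hQ hne₁ hne₂ hne₃
    (by rw [sLRB]; linarith [mul_nonneg hs.le ha0, mul_nonneg (sub_pos.2 hab).le hc0])
    (by rw [sLRT]; exact hLRT0) (by rw [sLRP]; exact hLRP0) (by rw [sLRQ]; exact hLRQ0)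
    (by rw [sBRP]; linarith) (by rw [sLTQ]; exact hH)
  rw [sLRB, sLRT, sBRP, sLTQ] at hvol
  refine ⟨by linarith, fun hv => ?_⟩
  have hcoef : 0 ≤ 4 * s * t - s ^ 2 := by
    have := mul_le_mul_of_nonneg_left hst hs.le
    have := mul_pos hs hs
    linarith
  -- In the first position `LRB` alone has area `2st - s²/2`, in the second `RLT` does. The point
  -- `(α, β)` is the centre of the box.
  rcases heq (le_antisymm hle (by linarith)) with ⟨rfl, rfl, rfl, rfl⟩ | ⟨rfl, rfl, rfl, rfl⟩
  · refine ⟨L, R, B, X L + c, Y B + t, 1, Or.inl rfl, ?_, by ring, by linarith, by linarith,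
      by linarith, hc, by linarith⟩
    apply eq_triangle_of_volume h hK hKc hKi hL hR hB
    rw [hv, sLRB, abs_neg, abs_of_nonneg (by linarith)]
    ring
  · refine ⟨R, L, T, X L + d, Y B + t, -1, Or.inr rfl, ?_, by linarith, by linarith, by ring,
      by linarith, hd, by linarith⟩
    apply eq_triangle_of_volume h hK hKc hKi hR hL hT
    have : signedArea X Y R L T = - signedArea X Y L R T := by simp only [signedArea]; ring
    rw [hv, this, sLRT, abs_neg, abs_of_nonneg (by linarith)]
    ring

theorem halfWidth_neg (K : Set Plane) (hK : IsCompact K) (hne : K.Nonempty) (f : Plane →ₗ[ℝ] ℝ) :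
    halfWidth K (-f) = halfWidth K f := by
  obtain ⟨p, hp, q, hq, hp', hq', h⟩ := exists_extremal hK hne f
  rw [h, halfWidth_eq (f := -f) hq hp (by simpa using hq') (by simpa using hp')]
  simp; ring

theorem UnimodularPair.neg_left (h : UnimodularPair X Y) : UnimodularPair (-X) Y := by
  intro a b
  rw [← h a b, ← abs_neg]
  simp only [LinearMap.neg_apply]
  congr 1; ring

/-- The area of a convex body in terms of its widths along a lattice basis. -/
theorem area_bound_of_halfWidths (h : UnimodularPair X Y) {K : Set Plane} (hK : Convex ℝ K)
    (hKc : IsCompact K) (hKi : (interior K).Nonempty) {s t : ℝ} (hs : 0 < s) (hst : s ≤ t)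
    (hX : halfWidth K X = s) (hY : halfWidth K Y = t) (hw : t ≤ halfWidth K (Y - X))
    (hw' : t ≤ halfWidth K (Y + X)) :
    2 * s * t - s ^ 2 / 2 ≤ volume.real K ∧
      (volume.real K = 2 * s * t - s ^ 2 / 2 →
        IsExtremalTriangle X Y K s t ∨ IsExtremalTriangle (-X) Y K s t) := by
  have hne : K.Nonempty := hKi.mono interior_subset
  have hfin : volume K ≠ ⊤ := hKc.measure_lt_top.ne
  obtain ⟨R, hR, L, hL, hR', hL', hRL⟩ := exists_extremal hKc hne X
  obtain ⟨T, hT, B, hB, hT', hB', hTB⟩ := exists_extremal hKc hne Y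
  have hLR : X R - X L = 2 * s := by linarith
  have hBT : Y T - Y B = 2 * t := by linarith
  -- If the product is nonpositive, the quadrilateral has area at least `2st`, strictly above the
  -- bound. If both factors are negative, the reflection `X ↦ -X` exchanges `L` and `R` and makes
  -- them positive.
  rcases le_or_gt ((Y R - Y L) * (X T - X B)) 0 with hpq | hpq
  · have hB0 := hB' L hL
    have hB1 := hB' R hR
    have hT0 := hT' L hL
    have hT1 := hT' R hR
    have k₁ := mul_nonneg (sub_nonneg.2 (hL' B hB)) (sub_nonneg.2 hB1)
    have k₂ := mul_nonneg (sub_nonneg.2 (hR' B hB)) (sub_nonneg.2 hB0)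
    have k₃ := mul_nonneg (sub_nonneg.2 (hL' T hT)) (sub_nonneg.2 hT1)
    have k₄ := mul_nonneg (sub_nonneg.2 (hR' T hT)) (sub_nonneg.2 hT0)
    have hvol := volume_ge_of_quadrilateral h hK hfin hL hR hB hT
      (by rintro rfl; linarith)
      (by simp only [signedArea]; linarith)
      (by simp only [signedArea]; linarith)
    have e : signedArea X Y L R T - signedArea X Y L R B =
        (X R - X L) * (Y T - Y B) - (Y R - Y L) * (X T - X B) := by
      simp only [signedArea]; ring
    rw [e, hLR, hBT] at hvol
    have hs2 : 0 < s ^ 2 := by positivity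
    exact ⟨by linarith, fun hv => by exfalso; linarith⟩
  · rcases pos_and_pos_or_neg_and_neg_of_mul_pos hpq with ⟨hp, hq⟩ | ⟨hp, hq⟩
    · have hw₁ : t ≤ halfWidth K (X - Y) := by
        rwa [← neg_sub, halfWidth_neg K hKc hne]
      have := area_bound_of_positive_slopes h hK hKc hKi hs hst hL hR hB hT hL' hR' hB' hT' hLR hBT
        hw₁ (by linarith) (by linarith)
      exact ⟨this.1, fun hv => Or.inl (this.2 hv)⟩
    · have hw₁ : t ≤ halfWidth K (-X - Y) := by
        rw [← halfWidth_neg K hKc hne]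
        convert hw' using 2
        abel
      have := area_bound_of_positive_slopes h.neg_left hK hKc hKi hs hst hR hL hB hT
        (by simpa using hR') (by simpa using hL') hB' hT'
        (by simp only [LinearMap.neg_apply]; linarith) hBT hw₁ (by linarith)
        (by simp only [LinearMap.neg_apply]; linarith)
      exact ⟨this.1, fun hv => Or.inr (this.2 hv)⟩

/-! ### The half width as a norm on directions, and the polar body. -/

theorem le_halfWidth {K : Set Plane} (hK : IsCompact K) (f : Plane →ₗ[ℝ] ℝ) {p q : Plane}
    (hp : p ∈ K) (hq : q ∈ K) : (f p - f q) / 2 ≤ halfWidth K f := by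
  obtain ⟨p', _, q', _, h1, h2, h⟩ := exists_extremal hK ⟨p, hp⟩ f
  rw [h]
  linarith [h1 p hp, h2 q hq]

theorem halfWidth_add_le {K : Set Plane} (hK : IsCompact K) (hne : K.Nonempty)
    (f g : Plane →ₗ[ℝ] ℝ) : halfWidth K (f + g) ≤ halfWidth K f + halfWidth K g := by
  obtain ⟨p, hp, q, hq, -, -, h⟩ := exists_extremal hK hne (f + g)
  rw [h]
  have h1 := le_halfWidth hK f hp hq
  have h2 := le_halfWidth hK g hp hq
  simp only [LinearMap.add_apply]
  linarith

theorem halfWidth_smul {K : Set Plane} (hK : IsCompact K) (hne : K.Nonempty)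
    (c : ℝ) (f : Plane →ₗ[ℝ] ℝ) : halfWidth K (c • f) = |c| * halfWidth K f := by
  have key : ∀ c : ℝ, 0 ≤ c → ∀ f : Plane →ₗ[ℝ] ℝ, halfWidth K (c • f) = c * halfWidth K f := by
    intro c hc f
    obtain ⟨p, hp, q, hq, h1, h2, h⟩ := exists_extremal hK hne f
    rw [h, halfWidth_eq (f := c • f) hp hq
      (fun x hx => mul_le_mul_of_nonneg_left (h1 x hx) hc)
      (fun x hx => mul_le_mul_of_nonneg_left (h2 x hx) hc)]
    simp; ring
  rcases le_total 0 c with hc | hc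
  · rw [abs_of_nonneg hc, key c hc]
  · have e : -(c • f) = (-c) • f := by ext x; simp
    rw [abs_of_nonpos hc, ← halfWidth_neg K hK hne, e, key (-c) (by linarith)]

/-- Half the width of `K` in direction `y`. -/
noncomputable def directionalWidth (K : Set Plane) (y : Plane) : ℝ := halfWidth K (innerₗ Plane y)

theorem inner_eq (x y : Plane) : inner ℝ x y = x 0 * y 0 + x 1 * y 1 := by
  simp [PiLp.inner_apply, Fin.sum_univ_two, mul_comm]

/-- The maximum of `⟨x, y⟩` over `x ∈ cs(K)` is attained at half the difference of two extremal
points of `K`, and equals the half width along `y`. -/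
theorem mem_smul_polar_iff {K : Set Plane} (hK : IsCompact K) (hne : K.Nonempty) {r : ℝ}
    (hr : 0 < r) (y : Plane) :
    y ∈ r • polarBody (centralSymmetral K) ↔ directionalWidth K y ≤ r := by
  rw [Set.mem_smul_set_iff_inv_smul_mem₀ hr.ne']
  have key : ∀ p q : Plane, inner ℝ ((1 / 2 : ℝ) • (p - q)) (r⁻¹ • y) =
      r⁻¹ * ((innerₗ Plane y p - innerₗ Plane y q) / 2) := by
    intro p q
    rw [inner_smul_left, inner_smul_right, inner_sub_left]
    simp [real_inner_comm]; ring
  constructor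
  · intro h
    obtain ⟨p, hp, q, hq, -, -, hw⟩ := exists_extremal hK hne (innerₗ Plane y)
    have := h ((1 / 2 : ℝ) • (p - q)) (Set.smul_mem_smul_set (Set.sub_mem_sub hp hq))
    rw [key, ← hw, inv_mul_le_iff₀ hr, mul_one] at this
    exact this
  · rintro h _ ⟨_, ⟨p, hp, q, hq, rfl⟩, rfl⟩
    change inner ℝ ((1 / 2 : ℝ) • (p - q)) (r⁻¹ • y) ≤ 1
    rw [key, inv_mul_le_iff₀ hr, mul_one]
    exact (le_halfWidth hK _ hp hq).trans h

theorem directionalWidth_add_le {K : Set Plane} (hK : IsCompact K) (hne : K.Nonempty)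
    (y z : Plane) : directionalWidth K (y + z) ≤ directionalWidth K y + directionalWidth K z := by
  simpa only [directionalWidth, map_add] using halfWidth_add_le hK hne _ _

theorem directionalWidth_smul {K : Set Plane} (hK : IsCompact K) (hne : K.Nonempty)
    (c : ℝ) (y : Plane) : directionalWidth K (c • y) = |c| * directionalWidth K y := by
  simpa only [directionalWidth, map_smul] using halfWidth_smul hK hne _ _

/-- `K` contains a ball, hence a segment of fixed length in each coordinate direction. This
coercivity leaves only finitely many lattice vectors of bounded width. -/
theorem exists_directionalWidth_ge {K : Set Plane} (hK : IsCompact K)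
    (hKi : (interior K).Nonempty) :
    ∃ δ > 0, ∀ y : Plane, ∀ i, δ * |y i| ≤ directionalWidth K y := by
  obtain ⟨x, hx⟩ := hKi
  obtain ⟨ε, hε, hball⟩ := Metric.isOpen_iff.1 isOpen_interior x hx
  have hmem : ∀ z : Plane, ‖z‖ < ε → x + z ∈ K := fun z hz =>
    interior_subset (hball (by simpa [Metric.mem_ball, dist_eq_norm] using hz))
  refine ⟨ε / 2, by positivity, fun y i => ?_⟩
  have hn : ∀ σ : ℝ, |σ| = 1 → ‖EuclideanSpace.single i (σ * (ε / 2))‖ < ε := by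
    intro σ hσ
    rw [PiLp.norm_single, norm_mul, Real.norm_eq_abs, hσ, Real.norm_eq_abs,
      abs_of_pos (by positivity)]
    linarith
  have key : ∀ σ : ℝ, |σ| = 1 → σ * (ε / 2) * y i ≤ directionalWidth K y := by
    intro σ hσ
    have := le_halfWidth hK (innerₗ Plane y) (hmem _ (hn σ hσ)) (hmem _ (hn (-σ) (by simpa)))
    simp only [map_add, innerₗ_apply_apply, EuclideanSpace.inner_single_right] at this
    simp only [conj_trivial] at this
    unfold directionalWidth
    linarith
  rcases abs_cases (y i) with ⟨h, -⟩ | ⟨h, -⟩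
  · rw [h]; simpa using key 1 (by simp)
  · rw [h]; have := key (-1) (by simp); linarith

/-- The lattice vector `(m, n)`. -/
noncomputable def latticeVector (m n : ℤ) : Plane := !₂[(m : ℝ), (n : ℝ)]

@[simp] theorem latticeVector_zero (m n : ℤ) : latticeVector m n 0 = m := rfl
@[simp] theorem latticeVector_one (m n : ℤ) : latticeVector m n 1 = n := rfl

theorem latticeVector_mem (m n : ℤ) : latticeVector m n ∈ integerLattice 2 := by
  intro i
  fin_cases i
  · exact ⟨m, rfl⟩
  · exact ⟨n, rfl⟩

theorem exists_eq_latticeVector {y : Plane} (hy : y ∈ integerLattice 2) :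
    ∃ m n : ℤ, y = latticeVector m n := by
  obtain ⟨m, hm⟩ := hy 0
  obtain ⟨n, hn⟩ := hy 1
  refine ⟨m, n, ?_⟩
  ext i; fin_cases i <;> simpa

theorem exists_minimal_latticeVector {K : Set Plane} (hK : IsCompact K)
    (hKi : (interior K).Nonempty) {S : Set (ℤ × ℤ)} (hS : S.Nonempty) :
    ∃ p ∈ S, ∀ q ∈ S, directionalWidth K (latticeVector p.1 p.2) ≤
      directionalWidth K (latticeVector q.1 q.2) := by
  obtain ⟨δ, hδ, h⟩ := exists_directionalWidth_ge hK hKi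
  obtain ⟨p₀, hp₀⟩ := hS
  set R := directionalWidth K (latticeVector p₀.1 p₀.2) with hR
  let S' : Set (ℤ × ℤ) := {q ∈ S | directionalWidth K (latticeVector q.1 q.2) ≤ R}
  have hfin : S'.Finite := by
    apply ((Set.finite_Icc (-⌈R / δ⌉) ⌈R / δ⌉).prod (Set.finite_Icc (-⌈R / δ⌉) ⌈R / δ⌉)).subset
    have key : ∀ k : ℤ, δ * |(k : ℝ)| ≤ R → k ∈ Set.Icc (-⌈R / δ⌉) ⌈R / δ⌉ := by
      intro k hk
      have h1 : |(k : ℝ)| ≤ ⌈R / δ⌉ :=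
        ((le_div_iff₀ hδ).2 (by linarith)).trans (Int.le_ceil _)
      exact abs_le.1 (by exact_mod_cast h1)
    rintro q ⟨-, hq⟩
    exact ⟨key _ ((h (latticeVector q.1 q.2) 0).trans hq),
      key _ ((h (latticeVector q.1 q.2) 1).trans hq)⟩
  obtain ⟨p, hp, hmin⟩ := Set.exists_min_image S'
    (fun q => directionalWidth K (latticeVector q.1 q.2)) hfin ⟨p₀, hp₀, le_rfl⟩
  refine ⟨p, hp.1, fun q hq => ?_⟩
  rcases le_total (directionalWidth K (latticeVector q.1 q.2)) R with hle | hle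
  · exact hmin q ⟨hq, hle⟩
  · exact hp.2.trans hle

/-! ### Reduced bases and the successive minima. -/

/-- `u`, `v` is a reduced basis of `ℤ²` for the width of `K`. -/
structure IsReducedBasis (K : Set Plane) (u v : Plane) : Prop where
  left_mem : u ∈ integerLattice 2
  right_mem : v ∈ integerLattice 2
  cross_eq : cross u v = 1 ∨ cross u v = -1
  pos : 0 < directionalWidth K u
  le : directionalWidth K u ≤ directionalWidth K v
  le_add : ∀ k : ℤ, directionalWidth K v ≤ directionalWidth K (v + (k : ℝ) • u)

/-- Take `u` of least width among nonzero lattice vectors, then `v` of least width among those with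
`cross u v = 1`, a set stable under `v ↦ v + k u`. -/
theorem exists_isReducedBasis {K : Set Plane} (hK : IsCompact K)
    (hKi : (interior K).Nonempty) : ∃ u v, IsReducedBasis K u v := by
  have hne : K.Nonempty := hKi.mono interior_subset
  obtain ⟨δ, hδ, hwide⟩ := exists_directionalWidth_ge hK hKi
  have hpos : ∀ q : ℤ × ℤ, q ≠ 0 → 0 < directionalWidth K (latticeVector q.1 q.2) := by
    intro q hq
    have : q.1 ≠ 0 ∨ q.2 ≠ 0 := by
      by_contra! h
      exact hq (Prod.ext h.1 h.2)
    rcases this with h | h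
    · exact (mul_pos hδ (abs_pos.2 (by simpa using h))).trans_le (hwide _ 0)
    · exact (mul_pos hδ (abs_pos.2 (by simpa using h))).trans_le (hwide _ 1)
  obtain ⟨⟨m, n⟩, hmn, hmin⟩ := exists_minimal_latticeVector hK hKi
    (S := {q | q ≠ 0}) ⟨(1, 0), by simp⟩
  have hmnpos := hpos _ hmn
  -- A shortest vector is primitive: dividing by a common factor `g > 1` would shrink its width.
  have hgcd : Int.gcd m n = 1 := by
    have hg : 0 < Int.gcd m n := by
      rw [Int.gcd_pos_iff]
      by_contra! h
      exact hmn (Prod.ext h.1 h.2)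
    obtain ⟨m', hm'⟩ := Int.gcd_dvd_left m n
    obtain ⟨n', hn'⟩ := Int.gcd_dvd_right m n
    set g := Int.gcd m n
    have hq : ((m', n') : ℤ × ℤ) ≠ 0 := by
      intro h
      simp only [Prod.mk_eq_zero] at h
      apply hmn
      simp [hm', hn', h.1, h.2]
    have h1 := hmin _ hq
    have h2 : latticeVector m n = (g : ℝ) • latticeVector m' n' := by
      ext i; fin_cases i
      · simp; exact_mod_cast hm'
      · simp; exact_mod_cast hn'
    have h3 := hpos _ hq
    simp only at h1 h3
    rw [h2, directionalWidth_smul hK hne, Nat.abs_cast] at h1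
    have h4 : (g : ℝ) ≤ 1 := by
      by_contra! hlt
      nlinarith
    have : g ≤ 1 := by exact_mod_cast h4
    omega
  obtain ⟨a, b, hab⟩ : ∃ a b : ℤ, m * a + n * b = 1 :=
    ⟨Int.gcdA m n, Int.gcdB m n, by rw [← Int.gcd_eq_gcd_ab, hgcd]; rfl⟩
  obtain ⟨⟨c, d⟩, hcd, hmin'⟩ := exists_minimal_latticeVector hK hKi
    (S := {q | m * q.2 - n * q.1 = 1}) ⟨(-b, a), by simp; linarith⟩
  simp only [Set.mem_ofPred_eq] at hcd hmin'
  refine ⟨latticeVector m n, latticeVector c d, latticeVector_mem _ _, latticeVector_mem _ _,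
    Or.inl ?_, hmnpos, hmin (c, d) ?_, fun k => ?_⟩
  · simp only [cross, latticeVector_zero, latticeVector_one]
    exact_mod_cast hcd
  · intro h
    simp only [Prod.mk_eq_zero] at h
    simp [h.1, h.2] at hcd
  · have h1 := hmin' (c + k * m, d + k * n) (by simp only; linear_combination hcd)
    convert h1 using 2
    ext i; fin_cases i <;> simp

theorem IsReducedBasis.exists_coords {K : Set Plane} {u v : Plane} (h : IsReducedBasis K u v)
    {y : Plane} (hy : y ∈ integerLattice 2) : ∃ a b : ℤ, y = (a : ℝ) • u + (b : ℝ) • v := by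
  obtain ⟨m, n, rfl⟩ := exists_eq_latticeVector hy
  obtain ⟨m₁, n₁, rfl⟩ := exists_eq_latticeVector h.left_mem
  obtain ⟨m₂, n₂, rfl⟩ := exists_eq_latticeVector h.right_mem
  have hc := h.cross_eq
  simp only [cross, latticeVector_zero, latticeVector_one] at hc
  rcases hc with hc | hc
  · refine ⟨m * n₂ - n * m₂, m₁ * n - n₁ * m, ?_⟩
    ext i; fin_cases i
    · simp; linear_combination -(m : ℝ) * hc
    · simp; linear_combination -(n : ℝ) * hc
  · refine ⟨-(m * n₂ - n * m₂), -(m₁ * n - n₁ * m), ?_⟩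
    ext i; fin_cases i
    · simp; linear_combination (m : ℝ) * hc
    · simp; linear_combination (n : ℝ) * hc

theorem exists_int_sub_mul_le (a b : ℤ) (hb : b ≠ 0) :
    ∃ k : ℤ, 2 * |(a : ℝ) - b * k| ≤ |(b : ℝ)| := by
  refine ⟨round ((a : ℝ) / b), ?_⟩
  have hb' : (b : ℝ) ≠ 0 := by exact_mod_cast hb
  have h := abs_sub_round ((a : ℝ) / b)
  have e : (a : ℝ) - b * round ((a : ℝ) / b) = b * ((a : ℝ) / b - round ((a : ℝ) / b)) := by
    field_simp
  rw [e, abs_mul]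
  nlinarith [abs_pos.2 hb']

/-- With `k` an integer nearest to `a / b`, the vector `b (v + k u)` differs from `a u + b v` by at
most `|b| / 2` times `u`. So the width of `a u + b v` is at least `|b| w(v) - (|b| / 2) w(u) ≥ (|b|
/ 2) w(v)`, which suffices for `|b| ≥ 2`. For `|b| = 1` the difference is zero. -/
theorem IsReducedBasis.right_le {K : Set Plane} {u v : Plane} (h : IsReducedBasis K u v)
    (hK : IsCompact K) (hne : K.Nonempty) (a b : ℤ) (hb : b ≠ 0) :
    directionalWidth K v ≤ directionalWidth K ((a : ℝ) • u + (b : ℝ) • v) := by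
  obtain ⟨k, hk⟩ := exists_int_sub_mul_le a b hb
  set w := (a : ℝ) • u + (b : ℝ) • v with hw
  have e : (b : ℝ) • (v + (k : ℝ) • u) = w + (-((a : ℝ) - b * k)) • u := by
    rw [hw]; module
  have h1 : |(b : ℝ)| * directionalWidth K (v + (k : ℝ) • u) ≤
      directionalWidth K w + |(a : ℝ) - b * k| * directionalWidth K u := by
    rw [← directionalWidth_smul hK hne, e]
    refine (directionalWidth_add_le hK hne _ _).trans ?_
    rw [directionalWidth_smul hK hne, abs_neg]
  have h2 := h.le_add k
  have hpos := h.pos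
  have hle := h.le
  have h3 : |(b : ℝ)| * directionalWidth K v ≤
      |(b : ℝ)| * directionalWidth K (v + (k : ℝ) • u) :=
    mul_le_mul_of_nonneg_left h2 (abs_nonneg _)
  have hb1 : (1 : ℝ) ≤ |(b : ℝ)| := by exact_mod_cast Int.one_le_abs hb
  rcases eq_or_lt_of_le (Int.one_le_abs hb) with hb2 | hb2
  · have hb3 : |(b : ℝ)| = 1 := by exact_mod_cast hb2.symm
    have h0 : (a : ℝ) - b * k = 0 := by
      have h4 : 2 * |a - b * k| ≤ 1 := by
        rw [hb3] at hk
        exact_mod_cast hk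
      have h5 : a - b * k = 0 := by
        rw [← abs_eq_zero]
        have := abs_nonneg (a - b * k)
        omega
      exact_mod_cast h5
    rw [h0, abs_zero, hb3] at h1
    linarith
  · have hb3 : (2 : ℝ) ≤ |(b : ℝ)| := by exact_mod_cast hb2
    have h4 : 2 * |(a : ℝ) - b * k| * directionalWidth K u ≤ |(b : ℝ)| * directionalWidth K u :=
      mul_le_mul_of_nonneg_right hk hpos.le
    have h5 : |(b : ℝ)| * directionalWidth K u ≤ |(b : ℝ)| * directionalWidth K v :=
      mul_le_mul_of_nonneg_left hle (abs_nonneg _)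
    have h6 : 2 * directionalWidth K v ≤ |(b : ℝ)| * directionalWidth K v :=
      mul_le_mul_of_nonneg_right hb3 (by linarith)
    linarith

theorem IsReducedBasis.left_le {K : Set Plane} {u v : Plane} (h : IsReducedBasis K u v)
    (hK : IsCompact K) (hne : K.Nonempty) {y : Plane} (hy : y ∈ integerLattice 2) (hy0 : y ≠ 0) :
    directionalWidth K u ≤ directionalWidth K y := by
  obtain ⟨a, b, rfl⟩ := h.exists_coords hy
  by_cases hb : b = 0
  · have ha : a ≠ 0 := by
      rintro rfl
      simp [hb] at hy0
    have ha1 : (1 : ℝ) ≤ |(a : ℝ)| := by exact_mod_cast Int.one_le_abs ha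
    simp only [hb, Int.cast_zero, zero_smul, add_zero]
    rw [directionalWidth_smul hK hne]
    nlinarith [h.pos]
  · exact h.le.trans (h.right_le hK hne a b hb)

theorem linearIndependent_pair_of_cross {u v : Plane} (h : cross u v ≠ 0) :
    LinearIndependent ℝ ![u, v] := by
  rw [LinearIndependent.pair_iff]
  intro a b hab
  have h0 : a * u 0 + b * v 0 = 0 := by simpa using congrArg (fun z : Plane => z 0) hab
  have h1 : a * u 1 + b * v 1 = 0 := by simpa using congrArg (fun z : Plane => z 1) hab
  unfold cross at h
  constructor
  · exact (mul_eq_zero.1 (by linear_combination v 1 * h0 - v 0 * h1 :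
      a * (u 0 * v 1 - u 1 * v 0) = 0)).resolve_right h
  · exact (mul_eq_zero.1 (by linear_combination u 0 * h1 - u 1 * h0 :
      b * (u 0 * v 1 - u 1 * v 0) = 0)).resolve_right h

theorem IsReducedBasis.successiveMinimum_one {K : Set Plane} {u v : Plane}
    (h : IsReducedBasis K u v) (hK : IsCompact K) (hne : K.Nonempty) :
    successiveMinimum (polarBody (centralSymmetral K)) 1 = directionalWidth K u := by
  apply IsLeast.csInf_eq
  constructor
  · refine ⟨h.pos, ?_⟩
    have hu : u ∈ directionalWidth K u • polarBody (centralSymmetral K) ∩ integerLattice 2 :=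
      ⟨(mem_smul_polar_iff hK hne h.pos u).2 le_rfl, h.left_mem⟩
    have hu0 : u ≠ 0 := by
      rintro rfl
      have := h.cross_eq
      simp [cross] at this
    rw [Nat.one_le_iff_ne_zero, Set.finrank, ne_eq, Submodule.finrank_eq_zero,
      Submodule.span_eq_bot]
    exact fun h => hu0 (h u hu)
  · rintro r ⟨hr, hr1⟩
    rw [Nat.one_le_iff_ne_zero, Set.finrank, ne_eq, Submodule.finrank_eq_zero,
      Submodule.span_eq_bot] at hr1
    push Not at hr1
    obtain ⟨y, hy, hy0⟩ := hr1
    exact (h.left_le hK hne hy.2 hy0).trans ((mem_smul_polar_iff hK hne hr y).1 hy.1)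

theorem IsReducedBasis.successiveMinimum_two {K : Set Plane} {u v : Plane}
    (h : IsReducedBasis K u v) (hK : IsCompact K) (hne : K.Nonempty) :
    successiveMinimum (polarBody (centralSymmetral K)) 2 = directionalWidth K v := by
  have hvpos := h.pos.trans_le h.le
  apply IsLeast.csInf_eq
  constructor
  · refine ⟨hvpos, ?_⟩
    have hli : LinearIndependent ℝ ![u, v] := linearIndependent_pair_of_cross (by
      rcases h.cross_eq with h | h <;> rw [h] <;> norm_num)
    have h2 := finrank_span_eq_card hli
    rw [Fintype.card_fin] at h2
    refine h2.ge.trans (Submodule.finrank_mono ?_)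
    apply Submodule.span_mono
    rintro _ ⟨i, rfl⟩
    fin_cases i
    · exact ⟨(mem_smul_polar_iff hK hne hvpos u).2 h.le, h.left_mem⟩
    · exact ⟨(mem_smul_polar_iff hK hne hvpos v).2 le_rfl, h.right_mem⟩
  · rintro r ⟨hr, hr2⟩
    by_contra! hlt
    -- Below the width of `v`, any lattice point must have zero `v`-coordinate, so such points span
    -- at most a line.
    have hsub : r • polarBody (centralSymmetral K) ∩ integerLattice 2 ⊆
        (Submodule.span ℝ {u} : Submodule ℝ Plane) := by
      rintro y ⟨hy, hyl⟩
      rw [mem_smul_polar_iff hK hne hr] at hy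
      obtain ⟨a, b, rfl⟩ := h.exists_coords hyl
      by_cases hb : b = 0
      · simp only [hb, Int.cast_zero, zero_smul, add_zero]
        exact Submodule.smul_mem _ _ (Submodule.mem_span_singleton_self u)
      · linarith [h.right_le hK hne a b hb]
    have h1 := Submodule.finrank_mono (Submodule.span_le.2 hsub)
    have h2 := finrank_span_le_card (R := ℝ) ({u} : Set Plane)
    simp only [Set.toFinset_singleton, Finset.card_singleton] at h2
    exact absurd (hr2.trans (h1.trans h2)) (by norm_num)

/-! ### Lattice coordinates and unimodular images of the triangle. -/

/-- The determinant in the new coordinates is `cross u v * cross a b`. -/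
theorem unimodularPair_inner {u v : Plane} (h : cross u v = 1 ∨ cross u v = -1) :
    UnimodularPair (innerₗ Plane u) (innerₗ Plane v) := by
  intro a b
  have : |cross u v| = 1 := by rcases h with h | h <;> rw [h] <;> simp
  rw [← one_mul |cross a b|, ← this, ← abs_mul]
  congr 1
  simp only [innerₗ_apply_apply, inner_eq, cross]
  ring

theorem toEuclideanLin_map_apply (M : Matrix (Fin 2) (Fin 2) ℤ) (x : Plane) (i : Fin 2) :
    Matrix.toEuclideanLin (M.map (Int.cast : ℤ → ℝ)) x i = M i 0 * x 0 + M i 1 * x 1 := by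
  fin_cases i <;> simp [Matrix.toEuclideanLin, Matrix.toLpLin_apply]

theorem image_triangle (M : Matrix (Fin 2) (Fin 2) ℤ) (w : Plane) (s t : ℝ) :
    (fun x => Matrix.toEuclideanLin (M.map (Int.cast : ℤ → ℝ)) x + w) '' triangle s t =
      convexHull ℝ {Matrix.toEuclideanLin (M.map (Int.cast : ℤ → ℝ)) !₂[-s, t - s] + w,
        Matrix.toEuclideanLin (M.map (Int.cast : ℤ → ℝ)) !₂[s, t] + w,
        Matrix.toEuclideanLin (M.map (Int.cast : ℤ → ℝ)) !₂[0, -t] + w} := by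
  let f : Plane →ᵃ[ℝ] Plane :=
    (Matrix.toEuclideanLin (M.map (Int.cast : ℤ → ℝ))).toAffineMap + AffineMap.const ℝ Plane w
  have h := f.image_convexHull {!₂[-s, t - s], !₂[s, t], !₂[0, -t]}
  rw [Set.image_insert_eq, Set.image_pair] at h
  exact h

theorem IsExtremalTriangle.unimodularlyEquivalent {K : Set Plane} {u v : Plane}
    (hu : u ∈ integerLattice 2) (hv : v ∈ integerLattice 2)
    (huv : cross u v = 1 ∨ cross u v = -1) {s t : ℝ}
    (h : IsExtremalTriangle (innerₗ Plane u) (innerₗ Plane v) K s t) :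
    UnimodularlyEquivalent K (triangle s t) := by
  obtain ⟨m₁, n₁, rfl⟩ := exists_eq_latticeVector hu
  obtain ⟨m₂, n₂, rfl⟩ := exists_eq_latticeVector hv
  obtain ⟨A, B, C, α, β, σ, hσ, hK, hA₁, hA₂, hB₁, hB₂, hC₁, hC₂⟩ := h
  simp only [innerₗ_apply_apply, inner_eq, latticeVector_zero, latticeVector_one] at *
  simp only [cross, latticeVector_zero, latticeVector_one] at huv
  obtain ⟨τ, hτ, hτσ⟩ : ∃ τ : ℤ, τ ^ 2 = 1 ∧ (τ : ℝ) = σ := by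
    rcases hσ with rfl | rfl
    · exact ⟨1, by norm_num, by norm_num⟩
    · exact ⟨-1, by norm_num, by norm_num⟩
  obtain ⟨ε, hε, hεc⟩ : ∃ ε : ℤ, ε ^ 2 = 1 ∧ m₁ * n₂ - n₁ * m₂ = ε := by
    rcases huv with h | h
    · exact ⟨1, by norm_num, by exact_mod_cast h⟩
    · exact ⟨-1, by norm_num, by exact_mod_cast h⟩
  -- `ε` times the adjugate is the inverse of the matrix with rows `u`, `v`; the sign `τ` absorbs
  -- the reflection in `± T_{s,t}`.
  let M : Matrix (Fin 2) (Fin 2) ℤ := (τ * ε) • !![n₂, -n₁; -m₂, m₁]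
  have hdet : IsUnit M.det := by
    have : M.det = τ ^ 2 * ε ^ 2 * ε := by
      simp [M, Matrix.det_fin_two]
      linear_combination τ ^ 2 * ε ^ 2 * hεc
    rw [this, hτ, hε, one_mul, one_mul]
    exact IsUnit.of_mul_eq_one ε (by linarith)
  have hεr : (ε : ℝ) ^ 2 = 1 := by exact_mod_cast hε
  have hεcr : (m₁ : ℝ) * n₂ - n₁ * m₂ = ε := by exact_mod_cast hεc
  refine ⟨Matrix.GeneralLinearGroup.mk'' M hdet,
    !₂[ε * (n₂ * α - n₁ * β), ε * (-m₂ * α + m₁ * β)], ?_⟩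
  have key : ∀ (Z : Plane) (x y : ℝ), (m₁ : ℝ) * Z 0 + n₁ * Z 1 = α + σ * x →
      (m₂ : ℝ) * Z 0 + n₂ * Z 1 = β + σ * y →
      Matrix.toEuclideanLin (M.map (Int.cast : ℤ → ℝ)) !₂[x, y] +
        !₂[ε * (n₂ * α - n₁ * β), ε * (-m₂ * α + m₁ * β)] = Z := by
    intro Z x y h1 h2
    ext i
    rw [PiLp.add_apply, toEuclideanLin_map_apply]
    fin_cases i
    · simp [M, hτσ]
      linear_combination -ε * n₂ * h1 + ε * n₁ * h2 + ε * Z 0 * hεcr + Z 0 * hεr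
    · simp [M, hτσ]
      linear_combination ε * m₂ * h1 - ε * m₁ * h2 + ε * Z 1 * hεcr + Z 1 * hεr
  change K = (fun x => Matrix.toEuclideanLin (M.map (Int.cast : ℤ → ℝ)) x + _) '' triangle s t
  rw [image_triangle, key A _ _ hA₁ hA₂, key B _ _ hB₁ hB₂, key C _ _ (by rw [hC₁]; ring) hC₂]
  exact hK

/-- A unimodular image of `T_{s,t}`, in adapted lattice coordinates. -/
theorem exists_coords_of_unimodularlyEquivalent {K : Set Plane} {s t : ℝ}
    (h : UnimodularlyEquivalent K (triangle s t)) :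
    ∃ u ∈ integerLattice 2, ∃ v ∈ integerLattice 2, (cross u v = 1 ∨ cross u v = -1) ∧
      ∃ A B C : Plane, ∃ α β : ℝ, K = convexHull ℝ {A, B, C} ∧
        innerₗ Plane u A = α - s ∧ innerₗ Plane v A = β + t - s ∧
        innerₗ Plane u B = α + s ∧ innerₗ Plane v B = β + t ∧
        innerₗ Plane u C = α ∧ innerₗ Plane v C = β - t := by
  obtain ⟨U, w, hK⟩ := h
  set M : Matrix (Fin 2) (Fin 2) ℤ := U.val
  obtain ⟨ε, hε, hεc⟩ : ∃ ε : ℤ, (ε = 1 ∨ ε = -1) ∧ M 0 0 * M 1 1 - M 0 1 * M 1 0 = ε :=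
    ⟨M.det, Int.isUnit_iff.1 ((Matrix.isUnit_iff_isUnit_det M).1 U.isUnit),
      (Matrix.det_fin_two M).symm⟩
  have hεcr : (M 0 0 : ℝ) * M 1 1 - M 0 1 * M 1 0 = ε := by exact_mod_cast hεc
  have hεr : (ε : ℝ) ^ 2 = 1 := by rcases hε with rfl | rfl <;> norm_num
  -- The two lattice vectors are the rows of the inverse of `M`, so up to a translation they recover
  -- the original coordinates of `T_{s,t}`.
  have key : ∀ (x y : ℝ),
      innerₗ Plane (latticeVector (ε * M 1 1) (-ε * M 0 1))
        (Matrix.toEuclideanLin (M.map (Int.cast : ℤ → ℝ)) !₂[x, y] + w) =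
        x + (ε * M 1 1 * w 0 - ε * M 0 1 * w 1) ∧
      innerₗ Plane (latticeVector (-ε * M 1 0) (ε * M 0 0))
        (Matrix.toEuclideanLin (M.map (Int.cast : ℤ → ℝ)) !₂[x, y] + w) =
        y + (-ε * M 1 0 * w 0 + ε * M 0 0 * w 1) := by
    intro x y
    simp only [innerₗ_apply_apply, inner_eq, PiLp.add_apply, toEuclideanLin_map_apply,
      latticeVector_zero, latticeVector_one]
    simp
    constructor
    · linear_combination ε * x * hεcr + x * hεr
    · linear_combination ε * y * hεcr + y * hεr
  rw [image_triangle] at hK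
  refine ⟨_, latticeVector_mem (ε * M 1 1) (-ε * M 0 1), _,
    latticeVector_mem (-ε * M 1 0) (ε * M 0 0), ?_, _, _, _,
    ε * M 1 1 * w 0 - ε * M 0 1 * w 1, -ε * M 1 0 * w 0 + ε * M 0 0 * w 1, hK, (key _ _).1.trans ?_,
    (key _ _).2.trans ?_, (key _ _).1.trans ?_, (key _ _).2.trans ?_, (key _ _).1.trans ?_,
    (key _ _).2.trans ?_⟩
  · have : cross (latticeVector (ε * M 1 1) (-ε * M 0 1)) (latticeVector (-ε * M 1 0) (ε * M 0 0)) =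
        ε := by
      simp [cross]
      linear_combination (ε : ℝ) ^ 2 * hεcr + (ε : ℝ) * hεr
    rw [this]
    rcases hε with rfl | rfl <;> norm_num
  all_goals ring

/-- The triangle `T_{s,t}` in lattice coordinates is reduced, with half widths `s`, `t`. -/
theorem reduced_of_triangle {u v A B C : Plane} {s t α β : ℝ} (hs : 0 < s) (hst : s ≤ t)
    (hu : u ∈ integerLattice 2) (hv : v ∈ integerLattice 2)
    (huv : cross u v = 1 ∨ cross u v = -1)
    (hA₁ : innerₗ Plane u A = α - s) (hA₂ : innerₗ Plane v A = β + t - s)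
    (hB₁ : innerₗ Plane u B = α + s) (hB₂ : innerₗ Plane v B = β + t)
    (hC₁ : innerₗ Plane u C = α) (hC₂ : innerₗ Plane v C = β - t) :
    IsReducedBasis (convexHull ℝ {A, B, C}) u v ∧
      directionalWidth (convexHull ℝ {A, B, C}) u = s ∧
      directionalWidth (convexHull ℝ {A, B, C}) v = t := by
  have hA : A ∈ convexHull ℝ {A, B, C} := subset_convexHull ℝ _ (by simp)
  have hB : B ∈ convexHull ℝ {A, B, C} := subset_convexHull ℝ _ (by simp)
  have hC : C ∈ convexHull ℝ {A, B, C} := subset_convexHull ℝ _ (by simp)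
  have hcpt : IsCompact (convexHull ℝ {A, B, C}) := Set.Finite.isCompact_convexHull ℝ (by simp)
  have hwu : directionalWidth (convexHull ℝ {A, B, C}) u = s := by
    rw [directionalWidth, halfWidth_eq hB hA
      (le_on_triangle _ (by linarith) le_rfl (by linarith))
      (ge_on_triangle _ le_rfl (by linarith) (by linarith)), hA₁, hB₁]
    ring
  have hwv : directionalWidth (convexHull ℝ {A, B, C}) v = t := by
    rw [directionalWidth, halfWidth_eq hB hC
      (le_on_triangle _ (by linarith) le_rfl (by linarith))
      (ge_on_triangle _ (by linarith) (by linarith) le_rfl), hB₂, hC₂]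
    ring
  refine ⟨⟨hu, hv, huv, by rw [hwu]; exact hs, by rw [hwu, hwv]; exact hst, fun k => ?_⟩, hwu, hwv⟩
  rw [hwv, directionalWidth, map_add, map_smul]
  -- Along `v + k u` the vertices `B`, `C` differ by `2t + ks`, and `A`, `C` by `2t - s - ks`. The
  -- first is at least `2t` for `k ≥ 0`, the second for `k ≤ -1`.
  rcases le_or_gt 0 k with hk | hk
  · have h := le_halfWidth hcpt (innerₗ Plane v + (k : ℝ) • innerₗ Plane u) hB hC
    simp only [LinearMap.add_apply, LinearMap.smul_apply, smul_eq_mul, hB₁, hB₂, hC₁, hC₂] at h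
    have hk' : (0 : ℝ) ≤ k := by exact_mod_cast hk
    have := mul_nonneg hk' hs.le
    linarith
  · have h := le_halfWidth hcpt (innerₗ Plane v + (k : ℝ) • innerₗ Plane u) hA hC
    simp only [LinearMap.add_apply, LinearMap.smul_apply, smul_eq_mul, hA₁, hA₂, hC₁, hC₂] at h
    have hk' : (k : ℝ) ≤ -1 := by exact_mod_cast Int.le_sub_one_of_lt hk
    have := mul_nonneg (by linarith : 0 ≤ -1 - (k : ℝ)) hs.le
    linarith

end PlanarPolar

/-! ### The main theorem. -/

open PlanarPolar in
theorem theorem1 (K : ConvexBody (EuclideanSpace ℝ (Fin 2)))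
    (hK : (interior (K : Set (EuclideanSpace ℝ (Fin 2)))).Nonempty)
    (l₁ l₂ : ℝ)
    (hl₁ : l₁ = PlanarPolar.successiveMinimum
      (PlanarPolar.polarBody (PlanarPolar.centralSymmetral (K : Set (EuclideanSpace ℝ (Fin 2))))) 1)
    (hl₂ : l₂ = PlanarPolar.successiveMinimum
      (PlanarPolar.polarBody (PlanarPolar.centralSymmetral (K : Set (EuclideanSpace ℝ (Fin 2))))) 2) :
    MeasureTheory.volume.real (K : Set (EuclideanSpace ℝ (Fin 2)))
        ≥ 3 / 2 * l₁ * l₂ + 1 / 2 * l₁ * (l₂ - l₁) ∧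
      3 / 2 * l₁ * l₂ + 1 / 2 * l₁ * (l₂ - l₁) = 2 * l₁ * l₂ - 1 / 2 * l₁ ^ 2 ∧
      (MeasureTheory.volume.real (K : Set (EuclideanSpace ℝ (Fin 2)))
          = 3 / 2 * l₁ * l₂ + 1 / 2 * l₁ * (l₂ - l₁) ↔
        ∃ s t : ℝ, 0 < s ∧ s ≤ t ∧
          PlanarPolar.UnimodularlyEquivalent (K : Set (EuclideanSpace ℝ (Fin 2)))
            (PlanarPolar.triangle s t)) := by
  have hcpt : IsCompact (K : Set Plane) := K.isCompact
  have hne : (K : Set Plane).Nonempty := K.nonempty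
  obtain ⟨u, v, h⟩ := exists_isReducedBasis hcpt hK
  rw [h.successiveMinimum_one hcpt hne] at hl₁
  rw [h.successiveMinimum_two hcpt hne] at hl₂
  have hpos : 0 < l₁ := hl₁ ▸ h.pos
  have hle : l₁ ≤ l₂ := by rw [hl₁, hl₂]; exact h.le
  -- Beyond the two minima, the area bound needs reducedness only for `k = ±1`.
  have hadd := h.le_add 1
  have hsub := h.le_add (-1)
  rw [Int.cast_one, one_smul, ← hl₂, directionalWidth, map_add] at hadd
  rw [Int.cast_neg, Int.cast_one, neg_one_smul, ← sub_eq_add_neg, ← hl₂, directionalWidth,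
    map_sub] at hsub
  have hring : 3 / 2 * l₁ * l₂ + 1 / 2 * l₁ * (l₂ - l₁) = 2 * l₁ * l₂ - l₁ ^ 2 / 2 := by ring
  obtain ⟨hbound, heq⟩ := area_bound_of_halfWidths (unimodularPair_inner h.cross_eq) K.convex hcpt
    hK hpos hle hl₁.symm hl₂.symm hsub hadd
  refine ⟨by rw [hring]; exact hbound, by ring, fun hv => ?_, ?_⟩
  · refine ⟨l₁, l₂, hpos, hle, ?_⟩
    rcases heq (hv.trans hring) with h' | h'
    · exact h'.unimodularlyEquivalent h.left_mem h.right_mem h.cross_eq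
    · rw [← map_neg] at h'
      refine h'.unimodularlyEquivalent ?_ h.right_mem ?_
      · intro i
        obtain ⟨m, hm⟩ := h.left_mem i
        exact ⟨-m, by simp [hm]⟩
      · have : cross (-u) v = -cross u v := by simp [cross]; ring
        rw [this]
        rcases h.cross_eq with h | h <;> rw [h] <;> norm_num
  · rintro ⟨s, t, hs, hst, hU⟩
    obtain ⟨u', hu', v', hv', huv', A, B, C, α, β, hKe, hA₁, hA₂, hB₁, hB₂, hC₁, hC₂⟩ :=
      exists_coords_of_unimodularlyEquivalent hU
    obtain ⟨hred, hwu, hwv⟩ := reduced_of_triangle hs hst hu' hv' huv' hA₁ hA₂ hB₁ hB₂ hC₁ hC₂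
    rw [← hKe] at hred hwu hwv
    -- The basis adapted to the triangle may differ from `u`, `v`, but any reduced basis computes
    -- the same successive minima.
    have e₁ : l₁ = s := by
      rw [hl₁, ← h.successiveMinimum_one hcpt hne, hred.successiveMinimum_one hcpt hne, hwu]
    have e₂ : l₂ = t := by
      rw [hl₂, ← h.successiveMinimum_two hcpt hne, hred.successiveMinimum_two hcpt hne, hwv]
    have harea : signedArea (innerₗ Plane u') (innerₗ Plane v') A B C = -(4 * s * t - s ^ 2) := by
      simp only [signedArea, hA₁, hA₂, hB₁, hB₂, hC₁, hC₂]
      ring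
    have hnn : 0 ≤ 4 * s * t - s ^ 2 := by
      have := mul_le_mul_of_nonneg_left hst hs.le
      have := mul_pos hs hs
      linarith
    rw [hring, e₁, e₂, hKe, Measure.real, volume_triangle_eq (unimodularPair_inner huv'), harea,
      abs_neg, abs_of_nonneg hnn, ENNReal.toReal_ofReal (by linarith)]
    ring
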